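/- Write $R=\mathbb C[x_0,\dots,x_4]$ for the homogeneous coordinate ring of $\mathbb P^4=\mathbb P^4_{\mathbb C}$; a linear form over $\mathbb P^4$ is an element of $R$ that is homogeneous of degree $1$ (possibly $0$). A matrix $S\in\mathrm{GL}_6(\mathbb C)$ acts on skew-symmetric $6\times6$ matrices $M$ of linear forms over $\mathbb P^4$ by $M\mapsto SMS^t$. Such an $M$ is called semistable if there is an $\mathrm{SL}_6(\mathbb C)$-invariant homogeneous polynomial function of positive degree on the vector space of these matrices that does not vanish at $M$. For linearly independent linear forms $l_0,\dots,l_4$ put $$B=\begin{pmatrix}0&l_0&l_1\\-l_0&0&l_2\\-l_1&-l_2&0\end{pmatrix}$$ and consider the following six normal forms, written in $3\times 3$ blocks: $$(a)\ \begin{pmatrix}A(l_3)&B\\B&A(l_4)\end{pmatrix},\qquad (b)\ \begin{pmatrix}B&0\\0&B_1\end{pmatrix},\qquad (c)\ \begin{pmatrix}B&0\\0&B_2\end{pmatrix},$$ $$(d)\ \begin{pmatrix}0&B\\B&D\end{pmatrix},\qquad (e)\ \begin{pmatrix}0&B\\B&A(l_3)\end{pmatrix},\qquad (f)\ \begin{pmatrix}0&B\\B&0\end{pmatrix},$$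 where $$A(l)=\begin{pmatrix}0&l&0\\-l&0&0\\0&0&0\end{pmatrix},\quad B_1=\begin{pmatrix}0&l_2&l_3\\-l_2&0&l_4\\-l_3&-l_4&0\end{pmatrix},\quad B_2=\begin{pmatrix}0&l_1&l_2\\-l_1&0&l_3\\-l_2&-l_3&0\end{pmatrix},\quad D=\begin{pmatrix}0&l_3&l_4\\-l_3&0&0\\-l_4&0&0\end{pmatrix}.$$ We say that $M$ is congruent to one of these normal forms if there are $S\in\mathrm{GL}_6(\mathbb C)$ and linearly independent linear forms $l_0,\dots,l_4$ such that $SMS^t$ is equal to it. For a skew-symmetric $6\times 6$ matrix $M$ of linear forms over $\mathbb P^4$, let $Y(M)\subseteq\mathbb P^4$ be the locus where $M$ has rank at most $2$, with the scheme structure given by the ideal of $4\times4$ Pfaffians of $M$, and let $Y^{\mathrm{top}}(M)$ be its top-dimensional component, i.e. the closed subscheme defined by the intersection of the primary components of maximal dimension of that ideal. **Proposition.** (1) Let $M$ be a semistable skew-symmetric $6\times 6$ matrix of linear forms over $\mathbb P^4$ with vanishing Pfaffian. Then $M$ is congruent to at most one of the normal forms $(a),\dots,(f)$. (2) The normal forms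 are told apart by $Y^{\mathrm{top}}$: if $N$ and $N'$ are normal forms of different types among $(a),\dots,(f)$, written in linearly independent linear forms $l_0,\dots,l_4$ and $l'_0,\dots,l'_4$ respectively, then $Y^{\mathrm{top}}(N)\neq Y^{\mathrm{top}}(N')$. -/

import Mathlib

/-- The homogeneous coordinate ring `ℂ[x₀, …, x₄]` of `ℙ⁴`. A linear form over `ℙ⁴` is an element
that is homogeneous of degree `1` (this includes `0`). -/
abbrev P4Ring : Type := MvPolynomial (Fin 5) ℂ

/-- A square matrix over `P4Ring` is a skew-symmetric matrix of linear forms over `ℙ⁴`. -/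
def IsSkewLinear (M : Matrix (Fin 6) (Fin 6) P4Ring) : Prop :=
  M.transpose = -M ∧ ∀ i j, (M i j).IsHomogeneous 1

/-- The Pfaffian of a skew-symmetric `2n × 2n` matrix, by expansion along the first row:
`Pf M = ∑_{j ≥ 1} (-1)^(j+1) m_{0j} Pf(M_{0j})`, where `M_{0j}` is `M` with the rows and columns
`0` and `j` deleted; in the code `j` is shifted by one. -/
def pfaffian {R : Type*} [CommRing R] : (n : ℕ) → Matrix (Fin (2 * n)) (Fin (2 * n)) R → R
  | 0, _ => 1
  | n + 1, M => ∑ j : Fin (2 * n + 1), (-1) ^ (j : ℕ) * M 0 j.succ *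
      pfaffian n (M.submatrix (fun k => (j.succAbove k).succ) (fun k => (j.succAbove k).succ))

/-- The congruence action `M ↦ S M Sᵗ` of complex matrices `S` on matrices of forms. -/
noncomputable def congruence (S : Matrix (Fin 6) (Fin 6) ℂ) (M : Matrix (Fin 6) (Fin 6) P4Ring) :
    Matrix (Fin 6) (Fin 6) P4Ring :=
  S.map MvPolynomial.C * M * (S.map MvPolynomial.C).transpose

/-- The coordinates of a matrix of linear forms: the coefficient of `x_k` in the entry `m_{ij}`. -/
noncomputable def linearCoeffs (M : Matrix (Fin 6) (Fin 6) P4Ring) : Fin 6 × Fin 6 × Fin 5 → ℂ :=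
  fun t => MvPolynomial.coeff (Finsupp.single t.2.2 1) (M t.1 t.2.1)

/-- Semistability (geometric invariant theory) for the action `M ↦ S M Sᵗ` of `SL₆(ℂ)` on the space
of skew-symmetric `6 × 6` matrices of linear forms over `ℙ⁴`: some invariant homogeneous polynomial
function of positive degree on this space does not vanish at `M`. -/
def IsSemistable (M : Matrix (Fin 6) (Fin 6) P4Ring) : Prop :=
  ∃ (d : ℕ) (f : MvPolynomial (Fin 6 × Fin 6 × Fin 5) ℂ), 0 < d ∧ f.IsHomogeneous d ∧
    (∀ N : Matrix (Fin 6) (Fin 6) P4Ring, IsSkewLinear N →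
      ∀ S : Matrix (Fin 6) (Fin 6) ℂ, S.det = 1 →
        MvPolynomial.eval (linearCoeffs (congruence S N)) f =
          MvPolynomial.eval (linearCoeffs N) f) ∧
    MvPolynomial.eval (linearCoeffs M) f ≠ 0

/-- Five linearly independent linear forms over `ℙ⁴`. -/
def IsLinearCoordinates (l : Fin 5 → P4Ring) : Prop :=
  (∀ k, (l k).IsHomogeneous 1) ∧ LinearIndependent ℂ l

/-- The labels of the six normal forms. -/
inductive FormType : Type
  | a | b | c | d | e | f

/-- The normal form of the given type, written in the linear forms `l₀, …, l₄`. -/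
noncomputable def normalForm (t : FormType) (l : Fin 5 → P4Ring) : Matrix (Fin 6) (Fin 6) P4Ring :=
  match t with
  | .a => !![     0,  l 3,    0,    0,  l 0,  l 1;
             -(l 3),    0,    0, -(l 0),    0,  l 2;
                  0,    0,    0, -(l 1), -(l 2),    0;
                  0,  l 0,  l 1,    0,  l 4,    0;
             -(l 0),    0,  l 2, -(l 4),    0,    0;
             -(l 1), -(l 2),    0,    0,    0,    0]
  | .b => !![     0,  l 0,  l 1,    0,    0,    0;
             -(l 0),    0,  l 2,    0,    0,    0;
             -(l 1), -(l 2),    0,    0,    0,    0;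
                  0,    0,    0,    0,  l 2,  l 3;
                  0,    0,    0, -(l 2),    0,  l 4;
                  0,    0,    0, -(l 3), -(l 4),    0]
  | .c => !![     0,  l 0,  l 1,    0,    0,    0;
             -(l 0),    0,  l 2,    0,    0,    0;
             -(l 1), -(l 2),    0,    0,    0,    0;
                  0,    0,    0,    0,  l 1,  l 2;
                  0,    0,    0, -(l 1),    0,  l 3;
                  0,    0,    0, -(l 2), -(l 3),    0]
  | .d => !![     0,    0,    0,    0,  l 0,  l 1;
                  0,    0,    0, -(l 0),    0,  l 2;
                  0,    0,    0, -(l 1), -(l 2),    0;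
                  0,  l 0,  l 1,    0,  l 3,  l 4;
             -(l 0),    0,  l 2, -(l 3),    0,    0;
             -(l 1), -(l 2),    0, -(l 4),    0,    0]
  | .e => !![     0,    0,    0,    0,  l 0,  l 1;
                  0,    0,    0, -(l 0),    0,  l 2;
                  0,    0,    0, -(l 1), -(l 2),    0;
                  0,  l 0,  l 1,    0,  l 3,    0;
             -(l 0),    0,  l 2, -(l 3),    0,    0;
             -(l 1), -(l 2),    0,    0,    0,    0]
  | .f => !![     0,    0,    0,    0,  l 0,  l 1;
                  0,    0,    0, -(l 0),    0,  l 2;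
                  0,    0,    0, -(l 1), -(l 2),    0;
                  0,  l 0,  l 1,    0,    0,    0;
             -(l 0),    0,  l 2,    0,    0,    0;
             -(l 1), -(l 2),    0,    0,    0,    0]

/-- `M` is congruent to the normal form of type `t`: `S M Sᵗ` equals that normal form for some
`S ∈ GL₆(ℂ)`, in some linearly independent linear forms `l₀, …, l₄`. -/
def IsCongruentToForm (M : Matrix (Fin 6) (Fin 6) P4Ring) (t : FormType) : Prop :=
  ∃ (S : GL (Fin 6) ℂ) (l : Fin 5 → P4Ring), IsLinearCoordinates l ∧
    congruence (S : Matrix (Fin 6) (Fin 6) ℂ) M = normalForm t l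

/-- The homogeneous ideal generated by the `4 × 4` Pfaffians of `M`; it defines the closed
subscheme `Y ⊆ ℙ⁴` of points where `M` has rank at most `2`. -/
noncomputable def pfaffianIdeal (M : Matrix (Fin 6) (Fin 6) P4Ring) : Ideal P4Ring :=
  Ideal.span (Set.range fun s : Fin 4 ↪o Fin 6 => pfaffian 2 (M.submatrix s s))

/-- For a homogeneous ideal `I` with associated subscheme `Y ⊆ ℙ⁴`, the saturated homogeneous ideal
of the top-dimensional component of `Y`: the intersection of the primary components of `I` that
belong to the primes of maximal dimension. The primary component at such a (minimal) prime `p` is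
the contraction of `I · R_p` to `R`. The irrelevant ideal, which has no point of `ℙ⁴`, is not
counted among the primes, so that the unit ideal is obtained when `Y` is empty. -/
noncomputable def topIdeal (I : Ideal P4Ring) : Ideal P4Ring :=
  ⨅ (p : PrimeSpectrum P4Ring)
    (_ : I ≤ p.asIdeal ∧ ringKrullDim (P4Ring ⧸ p.asIdeal) = ringKrullDim (P4Ring ⧸ I) ∧
      ¬ Ideal.span (Set.range (MvPolynomial.X : Fin 5 → P4Ring)) ≤ p.asIdeal),
    (I.map (algebraMap P4Ring (Localization.AtPrime p.asIdeal))).comap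
      (algebraMap P4Ring (Localization.AtPrime p.asIdeal))

/-! Congruence by an invertible matrix replaces the 4 × 4 Pfaffians by linear combinations of each
other, so `pfaffianIdeal` depends only on the congruence class
(`IsSkewLinear.pfaffianIdeal_congruence`). Hence (1) follows from (2), and it remains to separate
the six curves Y^top.

Geometrically, (a) is a smooth conic, (b) two skew lines in a hyperplane, (c) two lines meeting in a
point. The other three are multiple structures on one line: (d) a double line that spans a
hyperplane, (e) a double line in a plane, (f) the full first-order neighbourhood. Full primary
decompositions are not needed, because linear forms already tell the ideals J of Y^top apart. Only
for (a) does uv ∈ J force u ∈ J or v ∈ J for linear u, v. Among the rest, u² ∈ J forces u ∈ J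
exactly for (b) and (c). Within each of these two groups the dimension of the space of linear forms
in J decides: 1, 2 for (b), (c) and 1, 2, 0 for (d), (e), (f).

Linear forms are shown to lie in J by multiplying them into the Pfaffian ideal with elements outside
each relevant prime. They are excluded from J by parametrizing the curve over the dual numbers of
ℂ[s, t] (`IsLinearCoordinates.exists_topIdeal_le_ker`); the nilpotent part records the multiple
structure. All dimensions are those of affine cones, so a curve has dimension 2. -/

open MvPolynomial

/-! ### Krull dimension of quotients -/

/-- A ring all of whose prime quotients have dimension at most `n` has dimension at most `n`. -/
theorem ringKrullDim_quotient_le_of_forall_prime {R : Type*} [CommRing R] (I : Ideal R)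
    (n : WithBot ℕ∞)
    (h : ∀ p : PrimeSpectrum R, I ≤ p.asIdeal → ringKrullDim (R ⧸ p.asIdeal) ≤ n) :
    ringKrullDim (R ⧸ I) ≤ n := by
  rw [ringKrullDim_quotient, Order.krullDim_eq_iSup_coheight]
  refine iSup_le fun q => ?_
  -- The coheight of a prime q in V(I) is the length of chains upward from q, and these all lie in
  -- V(q).
  rw [Order.coheight_eq_krullDim_Ici]
  refine le_trans ?_ (h q.1 q.2)
  rw [ringKrullDim_quotient]
  exact Order.krullDim_le_of_strictMono
    (fun x => ⟨x.1.1, fun _ hy => (show q.1.asIdeal ≤ x.1.1.asIdeal from x.2) hy⟩)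
    (fun _ _ hab => hab)

/-- A chain of three primes above the kernel of a ring homomorphism. -/
theorem two_le_ringKrullDim_quotient_ker {R A B C : Type*} [CommRing R] [CommRing A] [IsDomain A]
    [CommRing B] [IsDomain B] [CommRing C] [IsDomain C] (f : R →+* A) (g : A →+* B) (h : B →+* C)
    (u w : R) (hu : f u ≠ 0) (hu' : g (f u) = 0) (hw : g (f w) ≠ 0) (hw' : h (g (f w)) = 0) :
    2 ≤ ringKrullDim (R ⧸ RingHom.ker f) := by
  rw [ringKrullDim_quotient]
  let p₀ : PrimeSpectrum.zeroLocus (R := R) (RingHom.ker f) :=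
    ⟨⟨RingHom.ker f, RingHom.ker_isPrime f⟩, fun _ hy => hy⟩
  let p₁ : PrimeSpectrum.zeroLocus (R := R) (RingHom.ker f) :=
    ⟨⟨RingHom.ker (g.comp f), RingHom.ker_isPrime _⟩, fun y hy => by
      have : f y = 0 := hy
      simp [RingHom.mem_ker, this]⟩
  let p₂ : PrimeSpectrum.zeroLocus (R := R) (RingHom.ker f) :=
    ⟨⟨RingHom.ker (h.comp (g.comp f)), RingHom.ker_isPrime _⟩, fun y hy => by
      have : f y = 0 := hy
      simp [RingHom.mem_ker, this]⟩
  have h₀ : p₀ < p₁ := by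
    refine lt_of_le_of_ne (fun y hy => ?_) fun he => hu ?_
    · have : f y = 0 := hy
      simp [p₁, RingHom.mem_ker, this]
    · have : u ∈ p₁.1.asIdeal := hu'
      rw [← he] at this
      exact this
  have h₁ : p₁ < p₂ := by
    refine lt_of_le_of_ne (fun y hy => ?_) fun he => hw ?_
    · have : g (f y) = 0 := hy
      simp [p₂, RingHom.mem_ker, this]
    · have : w ∈ p₂.1.asIdeal := hw'
      rw [← he] at this
      exact this
  refine le_trans ?_ (Order.coheight_le_krullDim p₀)
  have e₀ := Order.coheight_add_one_le h₀
  have e₁ := Order.coheight_add_one_le h₁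
  have : (2 : ℕ∞) ≤ Order.coheight p₀ := by
    refine le_trans ?_ e₀
    refine le_trans ?_ (add_le_add_left e₁ 1)
    rw [add_assoc, one_add_one_eq_two]
    exact le_add_self
  exact WithBot.coe_le_coe.2 this

/-! ### Linear coordinates -/

section coordinates

variable {l : Fin 5 → P4Ring}

theorem IsLinearCoordinates.span_eq (hl : IsLinearCoordinates l) :
    Submodule.span ℂ (Set.range l) = homogeneousSubmodule (Fin 5) ℂ 1 := by
  have hX : LinearIndependent ℂ (X : Fin 5 → P4Ring) := linearIndependent_X _ _
  have hfin : Module.finrank ℂ (homogeneousSubmodule (Fin 5) ℂ 1) = 5 := by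
    rw [homogeneousSubmodule_one_eq_span_X, finrank_span_eq_card hX]; simp
  have : FiniteDimensional ℂ (homogeneousSubmodule (Fin 5) ℂ 1) :=
    Module.finite_of_finrank_pos (by omega)
  refine Submodule.eq_of_le_of_finrank_eq ?_ ?_
  · rw [Submodule.span_le]
    rintro _ ⟨i, rfl⟩
    exact hl.1 i
  · rw [hfin, finrank_span_eq_card hl.2]; simp

theorem IsLinearCoordinates.exists_sum (hl : IsLinearCoordinates l) {u : P4Ring}
    (hu : u.IsHomogeneous 1) : ∃ c : Fin 5 → ℂ, ∑ i, c i • l i = u := by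
  have : u ∈ Submodule.span ℂ (Set.range l) := by rw [hl.span_eq]; exact hu
  exact (Submodule.mem_span_range_iff_exists_fun ℂ).1 this

/-- Linear coordinates may be sent to arbitrary elements by an algebra homomorphism. -/
theorem IsLinearCoordinates.exists_algHom (hl : IsLinearCoordinates l) {A : Type*} [CommRing A]
    [Algebra ℂ A] (v : Fin 5 → A) : ∃ f : P4Ring →ₐ[ℂ] A, ∀ i, f (l i) = v i := by
  obtain ⟨φ, hφ⟩ := LinearMap.exists_extend ((Module.Basis.span hl.2).constr ℂ v)
  have hφl : ∀ i, φ (l i) = v i := fun i => by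
    have h := LinearMap.congr_fun hφ (Module.Basis.span hl.2 i)
    rw [Module.Basis.constr_basis] at h
    rw [← h, LinearMap.comp_apply, Submodule.subtype_apply, Module.Basis.span_apply]
  -- The extension φ is merely linear on all polynomials. Only its values on the variables are used,
  -- and f agrees with φ in degree 1.
  let f : P4Ring →ₐ[ℂ] A := aeval fun j => φ (X j)
  refine ⟨f, fun i => ?_⟩
  rw [← hφl i]
  have hmem : l i ∈ Submodule.span ℂ (Set.range (X : Fin 5 → P4Ring)) := by
    rw [← homogeneousSubmodule_one_eq_span_X]
    exact hl.1 i
  have heq : Set.EqOn f.toLinearMap φ (Set.range (X : Fin 5 → P4Ring)) := by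
    rintro _ ⟨j, rfl⟩
    simp [f]
  exact LinearMap.eqOn_span heq hmem

theorem IsLinearCoordinates.adjoin_eq_top (hl : IsLinearCoordinates l) :
    Algebra.adjoin ℂ (Set.range l) = ⊤ := by
  rw [eq_top_iff, ← adjoin_range_X, Algebra.adjoin_le_iff]
  rintro _ ⟨j, rfl⟩
  obtain ⟨c, hc⟩ := hl.exists_sum (isHomogeneous_X ℂ j)
  rw [← hc]
  exact sum_mem fun i _ => Subalgebra.smul_mem _ (Algebra.subset_adjoin (Set.mem_range_self i)) _

/-- The irrelevant ideal is not contained in a prime that misses some coordinate. -/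
theorem IsLinearCoordinates.exists_notMem (hl : IsLinearCoordinates l) {p : Ideal P4Ring}
    (hp : ¬ Ideal.span (Set.range (X : Fin 5 → P4Ring)) ≤ p) : ∃ i, l i ∉ p := by
  by_contra! h
  refine hp (Ideal.span_le.2 ?_)
  rintro _ ⟨j, rfl⟩
  obtain ⟨c, hc⟩ := hl.exists_sum (isHomogeneous_X ℂ j)
  rw [SetLike.mem_coe, ← hc]
  exact sum_mem fun i _ => by rw [smul_eq_C_mul]; exact p.mul_mem_left _ (h i)

theorem IsLinearCoordinates.not_irrelevant_le (hl : IsLinearCoordinates l) {p : Ideal P4Ring}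
    {i : Fin 5} (hi : l i ∉ p) : ¬ Ideal.span (Set.range (X : Fin 5 → P4Ring)) ≤ p := by
  intro h
  apply hi
  have hmem : l i ∈ Submodule.span ℂ (Set.range (X : Fin 5 → P4Ring)) := by
    rw [← homogeneousSubmodule_one_eq_span_X]
    exact hl.1 i
  exact h (Submodule.span_le_restrictScalars ℂ P4Ring _ hmem)

/-- The quotient by an ideal is a quotient of the polynomial ring in the coordinates that are
not in the ideal. -/
theorem IsLinearCoordinates.aeval_mk_surjective (hl : IsLinearCoordinates l) (I : Ideal P4Ring)
    {m : ℕ} (σ : Fin m → Fin 5) (h : ∀ i, l i ∈ I ∨ i ∈ Set.range σ) :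
    Function.Surjective
      (aeval fun j => Ideal.Quotient.mkₐ ℂ I (l (σ j)) : MvPolynomial (Fin m) ℂ →ₐ[ℂ] P4Ring ⧸ I) := by
  set g := (aeval fun j => Ideal.Quotient.mkₐ ℂ I (l (σ j)) :
    MvPolynomial (Fin m) ℂ →ₐ[ℂ] P4Ring ⧸ I) with hg
  have hle : (⊤ : Subalgebra ℂ P4Ring) ≤ g.range.comap (Ideal.Quotient.mkₐ ℂ I) := by
    rw [← hl.adjoin_eq_top, Algebra.adjoin_le_iff]
    rintro _ ⟨i, rfl⟩
    rcases h i with hi | ⟨j, rfl⟩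
    · refine ⟨0, ?_⟩
      rw [eq_comm, map_zero]
      exact Ideal.Quotient.eq_zero_iff_mem.2 hi
    · exact ⟨X j, by simp [hg]⟩
  intro y
  obtain ⟨x, rfl⟩ := Ideal.Quotient.mk_surjective y
  exact hle (Algebra.mem_top (x := x))

theorem ringKrullDim_mvPolynomial_fin (m : ℕ) :
    ringKrullDim (MvPolynomial (Fin m) ℂ) = m := by
  rw [MvPolynomial.ringKrullDim_of_isNoetherianRing, ringKrullDim_eq_zero_of_field]; simp

theorem IsLinearCoordinates.ringKrullDim_quotient_le (hl : IsLinearCoordinates l)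
    (I : Ideal P4Ring) {m : ℕ} (σ : Fin m → Fin 5) (h : ∀ i, l i ∈ I ∨ i ∈ Set.range σ) :
    ringKrullDim (P4Ring ⧸ I) ≤ m := by
  rw [← ringKrullDim_mvPolynomial_fin m]
  exact ringKrullDim_le_of_surjective _ (hl.aeval_mk_surjective I σ h)

end coordinates

/-! ### Membership in the top-dimensional component -/

/-- Turns membership in a primary component into the existence of a multiplier outside the prime, so
that localizations need not be handled afterwards. -/
theorem mem_comap_map_atPrime_iff {R : Type*} [CommRing R] (I p : Ideal R) [p.IsPrime] (x : R) :
    x ∈ (I.map (algebraMap R (Localization.AtPrime p))).comap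
      (algebraMap R (Localization.AtPrime p)) ↔ ∃ s, s ∉ p ∧ s * x ∈ I := by
  rw [Ideal.mem_comap, IsLocalization.algebraMap_mem_map_algebraMap_iff p.primeCompl]
  simp [Ideal.primeCompl]

theorem le_topIdeal (I : Ideal P4Ring) : I ≤ topIdeal I :=
  le_iInf₂ fun _ _ => Ideal.le_comap_map

theorem mem_topIdeal_of_forall {I : Ideal P4Ring} {x : P4Ring}
    (h : ∀ p : Ideal P4Ring, p.IsPrime → I ≤ p →
      ringKrullDim (P4Ring ⧸ p) = ringKrullDim (P4Ring ⧸ I) →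
      ¬ Ideal.span (Set.range (X : Fin 5 → P4Ring)) ≤ p → ∃ s, s ∉ p ∧ s * x ∈ I) :
    x ∈ topIdeal I := by
  simp only [topIdeal, Ideal.mem_iInf]
  intro p hp
  rw [mem_comap_map_atPrime_iff]
  exact h p.asIdeal p.isPrime hp.1 hp.2.1 hp.2.2

/-- A homomorphism to dual numbers that kills `I` and whose reduction has a kernel of the right
dimension kills the top-dimensional component. -/
theorem topIdeal_le_ker {I : Ideal P4Ring} {K : Type*} [CommRing K] [IsDomain K]
    (f : P4Ring →+* DualNumber K) (g : P4Ring →+* K) (hg : ∀ x, g x = (f x).fst)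
    (hI : I ≤ RingHom.ker f)
    (hdim : ringKrullDim (P4Ring ⧸ RingHom.ker g) = ringKrullDim (P4Ring ⧸ I))
    (hirr : ¬ Ideal.span (Set.range (X : Fin 5 → P4Ring)) ≤ RingHom.ker g) :
    topIdeal I ≤ RingHom.ker f := by
  intro x hx
  simp only [topIdeal, Ideal.mem_iInf] at hx
  have hIg : I ≤ RingHom.ker g := fun y hy => by
    have : f y = 0 := hI hy
    simp [RingHom.mem_ker, hg, this]
  have := hx ⟨RingHom.ker g, RingHom.ker_isPrime g⟩ ⟨hIg, hdim, hirr⟩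
  rw [mem_comap_map_atPrime_iff] at this
  obtain ⟨s, hs, hsx⟩ := this
  have h0 : f s * f x = 0 := by rw [← map_mul]; exact hI hsx
  -- An element of the dual numbers over a domain with nonzero reduction is not a zero divisor.
  -- Comparing first the constant and then the nilpotent part of f s * f x = 0 gives f x = 0.
  have hs' : (f s).fst ≠ 0 := by rw [← hg]; exact hs
  have h1 : (f s).fst * (f x).fst = 0 := by rw [← TrivSqZeroExt.fst_mul, h0]; rfl
  have h2 : (f x).fst = 0 := (mul_eq_zero.1 h1).resolve_left hs'
  have h3 : (f s).fst * (f x).snd + (f s).snd * (f x).fst = 0 := by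
    rw [← DualNumber.snd_mul, h0]; rfl
  rw [h2, mul_zero, add_zero] at h3
  exact TrivSqZeroExt.ext h2 ((mul_eq_zero.1 h3).resolve_left hs')

/-! ### Pfaffians and their behaviour under congruence -/

theorem pfaffian_two {R : Type*} [CommRing R] (M : Matrix (Fin (2 * 2)) (Fin (2 * 2)) R) :
    pfaffian 2 M = M 0 1 * M 2 3 - M 0 2 * M 1 3 + M 0 3 * M 1 2 := by
  simp [pfaffian, Fin.sum_univ_succ, Fin.succAbove]
  ring_nf

/-- The `4 × 4` Pfaffian of a matrix in the rows and columns `i, j, k, l`. -/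
def pf4 {R : Type*} [CommRing R] (M : Matrix (Fin 6) (Fin 6) R) (i j k l : Fin 6) : R :=
  M i j * M k l - M i k * M j l + M i l * M j k

theorem pf4_mem {M : Matrix (Fin 6) (Fin 6) P4Ring} {i j k l : Fin 6}
    (hij : i < j) (hjk : j < k) (hkl : k < l) : pf4 M i j k l ∈ pfaffianIdeal M := by
  have hs : StrictMono ![i, j, k, l] := by
    rw [Fin.strictMono_iff_lt_succ]
    intro a
    fin_cases a <;> simp [hij, hjk, hkl]
  refine Ideal.subset_span ⟨OrderEmbedding.ofStrictMono _ hs, ?_⟩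
  simp only [pfaffian_two]
  rfl

theorem pfaffianIdeal_le_iff {M : Matrix (Fin 6) (Fin 6) P4Ring} {J : Ideal P4Ring} :
    pfaffianIdeal M ≤ J ↔ ∀ i j k l, i < j → j < k → k < l → pf4 M i j k l ∈ J := by
  refine ⟨fun h i j k l hij hjk hkl => h (pf4_mem hij hjk hkl), fun h => ?_⟩
  rw [pfaffianIdeal, Ideal.span_le]
  rintro _ ⟨s, rfl⟩
  simp only [pfaffian_two]
  exact h (s 0) (s 1) (s 2) (s 3) (s.strictMono (by decide)) (s.strictMono (by decide))
    (s.strictMono (by decide))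

/-- Lists the 15 four-element subsets of the six indices, so that a claim about all Pfaffians
becomes one conjunction for `simp`. -/
theorem exists_quadruple_cases {P : Fin 6 → Fin 6 → Fin 6 → Fin 6 → Prop}
    (h : P 0 1 2 3 ∧ P 0 1 2 4 ∧ P 0 1 2 5 ∧ P 0 1 3 4 ∧ P 0 1 3 5 ∧ P 0 1 4 5 ∧ P 0 2 3 4 ∧
      P 0 2 3 5 ∧ P 0 2 4 5 ∧ P 0 3 4 5 ∧ P 1 2 3 4 ∧ P 1 2 3 5 ∧ P 1 2 4 5 ∧ P 1 3 4 5 ∧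
      P 2 3 4 5) (i j k l : Fin 6) (hij : i < j) (hjk : j < k) (hkl : k < l) : P i j k l := by
  have key : ∀ i j k l : Fin 6, i < j → j < k → k < l → (i, j, k, l) ∈
      ([(0, 1, 2, 3), (0, 1, 2, 4), (0, 1, 2, 5), (0, 1, 3, 4), (0, 1, 3, 5), (0, 1, 4, 5),
        (0, 2, 3, 4), (0, 2, 3, 5), (0, 2, 4, 5), (0, 3, 4, 5), (1, 2, 3, 4), (1, 2, 3, 5),
        (1, 2, 4, 5), (1, 3, 4, 5), (2, 3, 4, 5)] : List (Fin 6 × Fin 6 × Fin 6 × Fin 6)) := by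
    decide
  obtain ⟨h1, h2, h3, h4, h5, h6, h7, h8, h9, h10, h11, h12, h13, h14, h15⟩ := h
  have := key i j k l hij hjk hkl
  simp only [List.mem_cons, Prod.mk.injEq, List.not_mem_nil, or_false] at this
  rcases this with ⟨rfl, rfl, rfl, rfl⟩ | ⟨rfl, rfl, rfl, rfl⟩ | ⟨rfl, rfl, rfl, rfl⟩ |
    ⟨rfl, rfl, rfl, rfl⟩ | ⟨rfl, rfl, rfl, rfl⟩ | ⟨rfl, rfl, rfl, rfl⟩ | ⟨rfl, rfl, rfl, rfl⟩ |
    ⟨rfl, rfl, rfl, rfl⟩ | ⟨rfl, rfl, rfl, rfl⟩ | ⟨rfl, rfl, rfl, rfl⟩ | ⟨rfl, rfl, rfl, rfl⟩ |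
    ⟨rfl, rfl, rfl, rfl⟩ | ⟨rfl, rfl, rfl, rfl⟩ | ⟨rfl, rfl, rfl, rfl⟩ | ⟨rfl, rfl, rfl, rfl⟩ <;>
  assumption

/-- Pfaffians of a skew-symmetric matrix with unordered or repeated indices lie in the ideal. -/
theorem IsSkewLinear.pf4_mem {M : Matrix (Fin 6) (Fin 6) P4Ring} (hM : IsSkewLinear M)
    (i j k l : Fin 6) : pf4 M i j k l ∈ pfaffianIdeal M := by
  have hs : ∀ a b, M b a = - M a b := fun a b => congrFun (congrFun hM.1 a) b
  have hd : ∀ a, M a a = 0 := fun a => self_eq_neg.1 (hs a a)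
  have h12 : ∀ i j k l, pf4 M j i k l = - pf4 M i j k l := fun i j k l => by
    simp only [pf4, hs i j]; ring
  have h23 : ∀ i j k l, pf4 M i k j l = - pf4 M i j k l := fun i j k l => by
    simp only [pf4, hs j k]; ring
  have h34 : ∀ i j k l, pf4 M i j l k = - pf4 M i j k l := fun i j k l => by
    simp only [pf4, hs k l]; ring
  have z12 : ∀ i k l, pf4 M i i k l = 0 := fun i k l => self_eq_neg.1 (h12 i i k l)
  have z23 : ∀ i j l, pf4 M i j j l = 0 := fun i j l => self_eq_neg.1 (h23 i j j l)
  have z34 : ∀ i j k, pf4 M i j k k = 0 := fun i j k => self_eq_neg.1 (h34 i j k k)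
  set I := pfaffianIdeal M
  have m12 : ∀ i j k l, pf4 M i j k l ∈ I → pf4 M j i k l ∈ I := fun i j k l h => by
    rw [h12]; exact I.neg_mem h
  have m23 : ∀ i j k l, pf4 M i j k l ∈ I → pf4 M i k j l ∈ I := fun i j k l h => by
    rw [h23]; exact I.neg_mem h
  have m34 : ∀ i j k l, pf4 M i j k l ∈ I → pf4 M i j l k ∈ I := fun i j k l h => by
    rw [h34]; exact I.neg_mem h
  -- Insertion sort by adjacent transpositions: here the last index moves into an increasing triple,
  -- and `s2` then does the same for the third index.
  have s3 : ∀ i j k l, i < j → j < k → pf4 M i j k l ∈ I := fun i j k l hij hjk => by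
    rcases lt_trichotomy k l with h | rfl | h
    · exact _root_.pf4_mem hij hjk h
    · rw [z34]; exact I.zero_mem
    apply m34
    rcases lt_trichotomy j l with h' | rfl | h'
    · exact _root_.pf4_mem hij h' h
    · rw [z23]; exact I.zero_mem
    apply m23
    rcases lt_trichotomy i l with h'' | rfl | h''
    · exact _root_.pf4_mem h'' h' hjk
    · rw [z12]; exact I.zero_mem
    · exact m12 _ _ _ _ (_root_.pf4_mem h'' hij hjk)
  have s2 : ∀ i j k l, i < j → pf4 M i j k l ∈ I := fun i j k l hij => by
    rcases lt_trichotomy j k with h | rfl | h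
    · exact s3 _ _ _ _ hij h
    · rw [z23]; exact I.zero_mem
    apply m23
    rcases lt_trichotomy i k with h' | rfl | h'
    · exact s3 _ _ _ _ h' h
    · rw [z12]; exact I.zero_mem
    · exact m12 _ _ _ _ (s3 _ _ _ _ h' hij)
  rcases lt_trichotomy i j with h | rfl | h
  · exact s2 _ _ _ _ h
  · rw [z12]; exact I.zero_mem
  · exact m12 _ _ _ _ (s2 _ _ _ _ h)

theorem IsSkewLinear.congruence {M : Matrix (Fin 6) (Fin 6) P4Ring} (hM : IsSkewLinear M)
    (S : Matrix (Fin 6) (Fin 6) ℂ) : IsSkewLinear (congruence S M) := by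
  refine ⟨?_, fun i j => ?_⟩
  · simp only [_root_.congruence, Matrix.transpose_mul, Matrix.transpose_transpose, hM.1]
    simp [Matrix.mul_assoc]
  · simp only [_root_.congruence, Matrix.mul_apply, Matrix.map_apply, Matrix.transpose_apply]
    refine IsHomogeneous.sum _ _ _ fun b _ => ?_
    rw [mul_comm, ← zero_add 1]
    refine (isHomogeneous_C _ _).mul (IsHomogeneous.sum _ _ _ fun a _ => ?_)
    rw [← zero_add 1]
    exact (isHomogeneous_C _ _).mul (hM.2 a b)

/-- The 4 × 4 Pfaffians are, up to a constant, the coordinates of M ∧ M, on which S acts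
multilinearly. The sum runs over all quadruples, including unordered and repeated ones, which avoids
the 4 × 4 minors of S. -/
theorem pf4_congruence (S : Matrix (Fin 6) (Fin 6) ℂ) (M : Matrix (Fin 6) (Fin 6) P4Ring)
    (i j k l : Fin 6) :
    pf4 (congruence S M) i j k l =
      ∑ a, ∑ b, ∑ c, ∑ d, C (S i a * S j b * S k c * S l d) * pf4 M a b c d := by
  have e : ∀ i j, congruence S M i j = ∑ a, ∑ b, C (S i a) * C (S j b) * M a b := fun i j => by
    simp only [_root_.congruence, Matrix.mul_apply, Matrix.map_apply, Matrix.transpose_apply,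
      Finset.sum_mul]
    rw [Finset.sum_comm]
    exact Finset.sum_congr rfl fun a _ => Finset.sum_congr rfl fun b _ => by ring
  have t1 : congruence S M i j * congruence S M k l =
      ∑ a, ∑ b, ∑ c, ∑ d, C (S i a * S j b * S k c * S l d) * (M a b * M c d) := by
    simp only [e, Finset.sum_mul]
    refine Finset.sum_congr rfl fun a _ => Finset.sum_congr rfl fun b _ => ?_
    simp only [Finset.mul_sum]
    refine Finset.sum_congr rfl fun c _ => Finset.sum_congr rfl fun d _ => ?_
    simp only [C_mul]; ring
  have t2 : congruence S M i k * congruence S M j l =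
      ∑ a, ∑ b, ∑ c, ∑ d, C (S i a * S j b * S k c * S l d) * (M a c * M b d) := by
    rw [e, e, Finset.sum_mul]
    refine Finset.sum_congr rfl fun a _ => ?_
    rw [Finset.mul_sum]
    refine Finset.sum_congr rfl fun b _ => ?_
    rw [Finset.sum_mul]
    refine Finset.sum_congr rfl fun c _ => ?_
    rw [Finset.mul_sum]
    refine Finset.sum_congr rfl fun d _ => ?_
    simp only [C_mul]; ring
  have t3 : congruence S M i l * congruence S M j k =
      ∑ a, ∑ b, ∑ c, ∑ d, C (S i a * S j b * S k c * S l d) * (M a d * M b c) := by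
    rw [e, e, Finset.sum_mul]
    refine Finset.sum_congr rfl fun a _ => ?_
    rw [Finset.mul_sum]
    refine Finset.sum_congr rfl fun b _ => ?_
    rw [Finset.mul_sum]
    refine Finset.sum_congr rfl fun c _ => ?_
    rw [Finset.sum_mul]
    refine Finset.sum_congr rfl fun d _ => ?_
    simp only [C_mul]; ring
  simp only [pf4]
  rw [t1, t2, t3]
  simp only [← Finset.sum_sub_distrib, ← Finset.sum_add_distrib]
  refine Finset.sum_congr rfl fun a _ => Finset.sum_congr rfl fun b _ =>
    Finset.sum_congr rfl fun c _ => Finset.sum_congr rfl fun d _ => ?_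
  ring

theorem IsSkewLinear.pfaffianIdeal_congruence_le {M : Matrix (Fin 6) (Fin 6) P4Ring}
    (hM : IsSkewLinear M) (S : Matrix (Fin 6) (Fin 6) ℂ) :
    pfaffianIdeal (_root_.congruence S M) ≤ pfaffianIdeal M := by
  rw [pfaffianIdeal_le_iff]
  intro i j k l _ _ _
  rw [pf4_congruence]
  exact sum_mem fun a _ => sum_mem fun b _ => sum_mem fun c _ => sum_mem fun d _ =>
    Ideal.mul_mem_left _ _ (hM.pf4_mem a b c d)

theorem congruence_congruence (S T : Matrix (Fin 6) (Fin 6) ℂ)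
    (M : Matrix (Fin 6) (Fin 6) P4Ring) :
    congruence S (congruence T M) = congruence (S * T) M := by
  simp only [congruence, Matrix.map_mul, Matrix.transpose_mul, Matrix.mul_assoc]

theorem congruence_one (M : Matrix (Fin 6) (Fin 6) P4Ring) : congruence 1 M = M := by
  simp [congruence, Matrix.map_one C (map_zero C) (map_one C)]

/-- The ideal of `4 × 4` Pfaffians is invariant under congruence. -/
theorem IsSkewLinear.pfaffianIdeal_congruence {M : Matrix (Fin 6) (Fin 6) P4Ring}
    (hM : IsSkewLinear M) (S : GL (Fin 6) ℂ) :
    pfaffianIdeal (_root_.congruence (S : Matrix (Fin 6) (Fin 6) ℂ) M) = pfaffianIdeal M := by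
  refine le_antisymm (hM.pfaffianIdeal_congruence_le _) ?_
  have h := (hM.congruence (S : Matrix (Fin 6) (Fin 6) ℂ)).pfaffianIdeal_congruence_le
    ((S⁻¹ : GL (Fin 6) ℂ) : Matrix (Fin 6) (Fin 6) ℂ)
  rwa [congruence_congruence, ← Units.val_mul, inv_mul_cancel, Units.val_one,
    congruence_one] at h

/-! ### Parametrized curves over the dual numbers -/

theorem ringKrullDim_quotient_anti {R : Type*} [CommRing R] {I J : Ideal R} (h : I ≤ J) :
    ringKrullDim (R ⧸ J) ≤ ringKrullDim (R ⧸ I) :=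
  ringKrullDim_le_of_surjective _ (Ideal.Quotient.factor_surjective h)

/-- A point of `ℙ⁴` over the dual numbers of `ℂ[s, t]` that lies on a surface cone kills the
top-dimensional component. -/
theorem IsLinearCoordinates.exists_topIdeal_le_ker {l : Fin 5 → P4Ring}
    (hl : IsLinearCoordinates l) {I : Ideal P4Ring} (hdim : ringKrullDim (P4Ring ⧸ I) ≤ 2)
    (v : Fin 5 → DualNumber (MvPolynomial (Fin 2) ℂ))
    (hI : ∀ f : P4Ring →+* DualNumber (MvPolynomial (Fin 2) ℂ), (∀ i, f (l i) = v i) →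
      I ≤ RingHom.ker f) (i j : Fin 5) {m : ℕ} (hi : (v i).fst = X 1 ^ (m + 1))
    {n : ℕ} (hj : (v j).fst = X 0 ^ (n + 1)) :
    ringKrullDim (P4Ring ⧸ I) = 2 ∧
      ∃ f : P4Ring →ₐ[ℂ] DualNumber (MvPolynomial (Fin 2) ℂ), (∀ i, f (l i) = v i) ∧
        ∀ x ∈ topIdeal I, f x = 0 := by
  obtain ⟨f, hf⟩ := hl.exists_algHom v
  obtain ⟨F, hF⟩ : ∃ F : P4Ring →+* DualNumber (MvPolynomial (Fin 2) ℂ), ∀ x, F x = f x :=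
    ⟨f.toRingHom, fun _ => rfl⟩
  obtain ⟨g, hg⟩ : ∃ g : P4Ring →+* MvPolynomial (Fin 2) ℂ, ∀ x, g x = (F x).fst :=
    ⟨(TrivSqZeroExt.fstHom ℂ (MvPolynomial (Fin 2) ℂ) (MvPolynomial (Fin 2) ℂ)).toRingHom.comp F,
      fun _ => rfl⟩
  have hFI : I ≤ RingHom.ker F := hI F fun i => by rw [hF, hf]
  have hgl : ∀ i, g (l i) = (v i).fst := fun i => by rw [hg, hF, hf]
  have hIg : I ≤ RingHom.ker g := fun y hy => by
    have : F y = 0 := hFI hy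
    rw [RingHom.mem_ker, hg, this, TrivSqZeroExt.fst_zero]
  -- The chain of primes pulls back (0) ⊂ (X 1) ⊂ (X 0, X 1) along g. The positive powers of X 1 and
  -- X 0 that are the values at l i and l j make both inclusions strict.
  obtain ⟨θ, hθ0, hθ1⟩ : ∃ θ : MvPolynomial (Fin 2) ℂ →+* MvPolynomial (Fin 2) ℂ,
      θ (X 0) = X 0 ∧ θ (X 1) = 0 :=
    ⟨(aeval ![X 0, 0] : MvPolynomial (Fin 2) ℂ →ₐ[ℂ] MvPolynomial (Fin 2) ℂ).toRingHom,
      by simp, by simp⟩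
  have h2 : 2 ≤ ringKrullDim (P4Ring ⧸ RingHom.ker g) := by
    refine two_le_ringKrullDim_quotient_ker g θ
      (constantCoeff : MvPolynomial (Fin 2) ℂ →+* ℂ) (l i) (l j) ?_ ?_ ?_ ?_
    · rw [hgl, hi]; exact pow_ne_zero _ (X_ne_zero _)
    · rw [hgl, hi, map_pow, hθ1, zero_pow (Nat.succ_ne_zero m)]
    · rw [hgl, hj, map_pow, hθ0]; exact pow_ne_zero _ (X_ne_zero _)
    · rw [hgl, hj, map_pow, hθ0, map_pow, constantCoeff_X, zero_pow (Nat.succ_ne_zero n)]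
  have h3 : ringKrullDim (P4Ring ⧸ RingHom.ker g) ≤ ringKrullDim (P4Ring ⧸ I) :=
    ringKrullDim_quotient_anti hIg
  refine ⟨le_antisymm hdim (h2.trans h3), f, hf, fun x hx => ?_⟩
  rw [← hF]
  refine topIdeal_le_ker F g hg hFI (le_antisymm h3 (hdim.trans h2)) ?_ hx
  refine hl.not_irrelevant_le (i := j) ?_
  rw [RingHom.mem_ker, hgl, hj]
  exact pow_ne_zero _ (X_ne_zero _)

theorem mem_pfaffianIdeal_of_eq {M : Matrix (Fin 6) (Fin 6) P4Ring} (i j k l : Fin 6)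
    {x : P4Ring} (h : i < j ∧ j < k ∧ k < l) (hx : pf4 M i j k l = x ∨ pf4 M i j k l = -x) :
    x ∈ pfaffianIdeal M := by
  have := pf4_mem (M := M) h.1 h.2.1 h.2.2
  rcases hx with hx | hx
  · rwa [hx] at this
  · rwa [hx, neg_mem_iff] at this

/-! ### Linear forms in an ideal -/

/-- The space of linear forms in an ideal. -/
noncomputable def linearPart (J : Ideal P4Ring) : Submodule ℂ P4Ring :=
  homogeneousSubmodule (Fin 5) ℂ 1 ⊓ J.restrictScalars ℂ

/-- Here `hs` is the lower bound, obtained from multipliers, and `h` the upper bound, obtained from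
parametrizations. -/
theorem IsLinearCoordinates.linearPart_eq {l : Fin 5 → P4Ring} (hl : IsLinearCoordinates l)
    {J : Ideal P4Ring} (s : Finset (Fin 5)) (hs : ∀ i ∈ s, l i ∈ J)
    (h : ∀ c : Fin 5 → ℂ, ∑ i, c i • l i ∈ J → ∀ i ∉ s, c i = 0) :
    linearPart J = Submodule.span ℂ (l '' s) := by
  refine le_antisymm (fun u hu => ?_) (Submodule.span_le.2 ?_)
  · obtain ⟨c, rfl⟩ := hl.exists_sum hu.1
    refine sum_mem fun i _ => ?_
    by_cases hi : i ∈ s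
    · exact Submodule.smul_mem _ _ (Submodule.subset_span ⟨i, hi, rfl⟩)
    · rw [h c hu.2 i hi, zero_smul]; exact Submodule.zero_mem _
  · rintro _ ⟨i, hi, rfl⟩
    exact ⟨hl.1 i, hs i hi⟩

theorem IsLinearCoordinates.finrank_linearPart {l : Fin 5 → P4Ring} (hl : IsLinearCoordinates l)
    {J : Ideal P4Ring} (s : Finset (Fin 5)) (hs : ∀ i ∈ s, l i ∈ J)
    (h : ∀ c : Fin 5 → ℂ, ∑ i, c i • l i ∈ J → ∀ i ∉ s, c i = 0) :
    Module.finrank ℂ (linearPart J) = s.card := by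
  rw [hl.linearPart_eq s hs h]
  have h1 : LinearIndependent ℂ (fun i : s => l i) := hl.2.comp _ Subtype.val_injective
  have h2 : l '' s = Set.range (fun i : s => l i) := by
    ext; simp
  rw [h2, finrank_span_eq_card h1]; simp

/-- Evaluation at scalar points turns a relation between the values v i into linear equations over ℂ
for the coefficients c i. -/
theorem sum_mul_eval_fst_eq_zero {c : Fin 5 → ℂ} {v : Fin 5 → DualNumber (MvPolynomial (Fin 2) ℂ)}
    (x : Fin 2 → ℂ) (h : (∑ i, c i • v i).fst = 0) :
    ∑ i, c i * eval x (v i).fst = 0 := by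
  have := congrArg (eval x) h
  simpa [TrivSqZeroExt.fst_sum, smul_eval] using this

theorem sum_mul_eval_snd_eq_zero {c : Fin 5 → ℂ} {v : Fin 5 → DualNumber (MvPolynomial (Fin 2) ℂ)}
    (x : Fin 2 → ℂ) (h : ∑ i, c i • v i = 0) :
    ∑ i, c i * eval x (v i).snd = 0 := by
  have := congrArg (fun z => eval x (TrivSqZeroExt.snd z)) h
  simpa [TrivSqZeroExt.snd_sum, smul_eval] using this

theorem sum_smul_mem_of_forall_coeff {l : Fin 5 → P4Ring} {J : Ideal P4Ring}
    (s : Finset (Fin 5)) (hs : ∀ i ∈ s, l i ∈ J) {c : Fin 5 → ℂ} (hc : ∀ i ∉ s, c i = 0) :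
    ∑ i, c i • l i ∈ J := by
  refine sum_mem fun i _ => ?_
  by_cases hi : i ∈ s
  · rw [smul_eq_C_mul]; exact J.mul_mem_left _ (hs i hi)
  · rw [hc i hi, zero_smul]; exact J.zero_mem

theorem notMem_of_forall_coeff {l : Fin 5 → P4Ring} {J : Ideal P4Ring} {s : Finset (Fin 5)}
    (h : ∀ c : Fin 5 → ℂ, ∑ i, c i • l i ∈ J → ∀ i ∉ s, c i = 0) {i : Fin 5} (hi : i ∉ s) :
    l i ∉ J := by
  intro hm
  have := h (Pi.single i 1) (by simpa [Pi.single_apply, ite_smul] using hm) i hi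
  simp at this

/-! ### Type (a): a smooth conic -/

/-- The quotient is generated by l 0, l 3, l 4, which satisfy a nonzero quadratic relation, so its
dimension is at most 3 - 1. -/
theorem conicCone_ringKrullDim_le {l : Fin 5 → P4Ring} (hl : IsLinearCoordinates l)
    {p : Ideal P4Ring} (h1 : l 1 ∈ p) (h2 : l 2 ∈ p) (hq : l 3 * l 4 - l 0 ^ 2 ∈ p) :
    ringKrullDim (P4Ring ⧸ p) ≤ 2 := by
  have hsurj := hl.aeval_mk_surjective p ![0, 3, 4] (by
    intro i; fin_cases i <;> simp [h1, h2])
  have hr : (X 1 * X 2 - X 0 ^ 2 : MvPolynomial (Fin 3) ℂ) ≠ 0 := fun h => by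
    have := congrArg (eval ![1, 0, 0]) h
    simp at this
  have := ringKrullDim_succ_le_of_surjective
    (aeval fun j => Ideal.Quotient.mkₐ ℂ p (l (![0, 3, 4] j)) :
      MvPolynomial (Fin 3) ℂ →ₐ[ℂ] P4Ring ⧸ p).toRingHom hsurj
    (mem_nonZeroDivisors_of_ne_zero hr) (by
      have : Ideal.Quotient.mkₐ ℂ p (l 3 * l 4 - l 0 ^ 2) = 0 :=
        Ideal.Quotient.eq_zero_iff_mem.2 hq
      simpa using this)
  rw [ringKrullDim_mvPolynomial_fin] at this
  have e : ((3 : ℕ) : WithBot ℕ∞) = 2 + 1 := by norm_num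
  rw [e] at this
  exact ENat.WithBot.add_le_add_one_right_iff.1 this

theorem ringKrullDim_normalForm_a_le {l : Fin 5 → P4Ring} (hl : IsLinearCoordinates l) :
    ringKrullDim (P4Ring ⧸ pfaffianIdeal (normalForm .a l)) ≤ 2 := by
  refine ringKrullDim_quotient_le_of_forall_prime _ _ fun p hp => ?_
  have h1 : l 1 * l 1 ∈ p.asIdeal := hp <| mem_pfaffianIdeal_of_eq 0 2 3 5 (by decide)
    (by simp [pf4, normalForm])
  have h2 : l 2 * l 2 ∈ p.asIdeal := hp <| mem_pfaffianIdeal_of_eq 1 2 4 5 (by decide)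
    (by simp [pf4, normalForm])
  refine conicCone_ringKrullDim_le hl (or_self_iff.1 (p.isPrime.mem_or_mem h1))
    (or_self_iff.1 (p.isPrime.mem_or_mem h2)) (hp <|
      mem_pfaffianIdeal_of_eq 0 1 3 4 (by decide) (by simp [pf4, normalForm]; ring_nf; simp))

/-- The parametrization of the conic has reduction in a domain, so one factor of a product in the
ideal vanishes on the conic. A linear form that vanishes there is a combination of l 1 and l 2, and
these lie in the ideal. -/
theorem topIdeal_normalForm_a {l : Fin 5 → P4Ring} (hl : IsLinearCoordinates l)
    {u v : P4Ring} (hu : u.IsHomogeneous 1) (hv : v.IsHomogeneous 1)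
    (huv : u * v ∈ topIdeal (pfaffianIdeal (normalForm .a l))) :
    u ∈ topIdeal (pfaffianIdeal (normalForm .a l)) ∨
      v ∈ topIdeal (pfaffianIdeal (normalForm .a l)) := by
  obtain ⟨-, f, hf, hJ⟩ := hl.exists_topIdeal_le_ker (ringKrullDim_normalForm_a_le hl)
    -- The conic l 3 * l 4 = l 0 ^ 2 in the plane l 1 = l 2 = 0, parametrized by (st, s², t²).
    ![TrivSqZeroExt.inl (X 0 * X 1), 0, 0, TrivSqZeroExt.inl (X 0 ^ 2),
     TrivSqZeroExt.inl (X 1 ^ 2)] (fun f hf => by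
      rw [pfaffianIdeal_le_iff]
      apply exists_quadruple_cases
      simp [pf4, normalForm, RingHom.mem_ker, hf]
      simp only [← TrivSqZeroExt.inl_mul]
      ring_nf) 4 3 (m := 1) (by simp) (n := 1) (by simp)
  have hs : ∀ i ∈ ({1, 2} : Finset (Fin 5)), l i ∈ topIdeal (pfaffianIdeal (normalForm .a l)) := by
    intro i hi
    refine mem_topIdeal_of_forall fun p _ _ _ hp => ?_
    -- Every product of l 1 or l 2 with a coordinate is a Pfaffian up to sign, so any coordinate
    -- outside p serves as multiplier.
    obtain ⟨j, hj⟩ := hl.exists_notMem hp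
    refine ⟨l j, hj, ?_⟩
    fin_cases hi
    · fin_cases j
      · exact mem_pfaffianIdeal_of_eq 0 1 3 5 (by decide) (by simp [pf4, normalForm, mul_comm])
      · exact mem_pfaffianIdeal_of_eq 0 2 3 5 (by decide) (by simp [pf4, normalForm])
      · exact mem_pfaffianIdeal_of_eq 0 2 4 5 (by decide) (by simp [pf4, normalForm, mul_comm])
      · exact mem_pfaffianIdeal_of_eq 0 1 2 3 (by decide) (by simp [pf4, normalForm, mul_comm])
      · exact mem_pfaffianIdeal_of_eq 0 3 4 5 (by decide) (by simp [pf4, normalForm, mul_comm])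
    · fin_cases j
      · exact mem_pfaffianIdeal_of_eq 0 1 4 5 (by decide) (by simp [pf4, normalForm])
      · exact mem_pfaffianIdeal_of_eq 0 2 4 5 (by decide) (by simp [pf4, normalForm])
      · exact mem_pfaffianIdeal_of_eq 1 2 4 5 (by decide) (by simp [pf4, normalForm])
      · exact mem_pfaffianIdeal_of_eq 0 1 2 4 (by decide) (by simp [pf4, normalForm, mul_comm])
      · exact mem_pfaffianIdeal_of_eq 1 3 4 5 (by decide) (by simp [pf4, normalForm, mul_comm])
  have key : ∀ u : P4Ring, u.IsHomogeneous 1 → (f u).fst = 0 →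
      u ∈ topIdeal (pfaffianIdeal (normalForm .a l)) := by
    intro u hu h0
    obtain ⟨c, rfl⟩ := hl.exists_sum hu
    simp only [map_sum, map_smul, hf] at h0
    have e1 := sum_mul_eval_fst_eq_zero ![1, 0] h0
    have e2 := sum_mul_eval_fst_eq_zero ![0, 1] h0
    have e3 := sum_mul_eval_fst_eq_zero ![1, 1] h0
    simp [Fin.sum_univ_five] at e1 e2 e3
    refine sum_smul_mem_of_forall_coeff {1, 2} hs fun i hi => ?_
    fin_cases i <;> simp_all
  have h0 : (f u).fst * (f v).fst = 0 := by
    rw [← TrivSqZeroExt.fst_mul, ← map_mul, hJ _ huv, TrivSqZeroExt.fst_zero]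
  exact (mul_eq_zero.1 h0).imp (key u hu) (key v hv)

/-- A form that is multiplied into `I` by `l₀, …, l₃` lies in the top-dimensional
component of `I` if that is a surface cone. -/
theorem IsLinearCoordinates.mem_topIdeal {l : Fin 5 → P4Ring} (hl : IsLinearCoordinates l)
    {I : Ideal P4Ring} (hdim : ringKrullDim (P4Ring ⧸ I) = 2) {x : P4Ring}
    (h0 : l 0 * x ∈ I) (h1 : l 1 * x ∈ I) (h2 : l 2 * x ∈ I) (h3 : l 3 * x ∈ I) :
    x ∈ topIdeal I := by
  refine mem_topIdeal_of_forall fun p _ _ hp _ => ?_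
  by_contra! h
  -- Without a multiplier among l 0, …, l 3, the prime contains all four of them and has dimension
  -- at most 1.
  have hp1 := hl.ringKrullDim_quotient_le p (![4] : Fin 1 → Fin 5) fun i => by
    fin_cases i
    · exact Or.inl (by_contra fun hn => h _ hn h0)
    · exact Or.inl (by_contra fun hn => h _ hn h1)
    · exact Or.inl (by_contra fun hn => h _ hn h2)
    · exact Or.inl (by_contra fun hn => h _ hn h3)
    · exact Or.inr ⟨0, rfl⟩
  rw [hp, hdim] at hp1
  have : (2 : ℕ) ≤ 1 := by exact_mod_cast hp1
  omega

/-! ### Dimension bounds for types (b) to (f) -/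

theorem ringKrullDim_normalForm_b_le {l : Fin 5 → P4Ring} (hl : IsLinearCoordinates l) :
    ringKrullDim (P4Ring ⧸ pfaffianIdeal (normalForm .b l)) ≤ 2 := by
  refine ringKrullDim_quotient_le_of_forall_prime _ _ fun p hp => ?_
  have h22 : l 2 * l 2 ∈ p.asIdeal := hp <|
    mem_pfaffianIdeal_of_eq 1 2 3 4 (by decide) (by simp [pf4, normalForm])
  have h03 : l 0 * l 3 ∈ p.asIdeal := hp <|
    mem_pfaffianIdeal_of_eq 0 1 3 5 (by decide) (by simp [pf4, normalForm])
  have h04 : l 0 * l 4 ∈ p.asIdeal := hp <|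
    mem_pfaffianIdeal_of_eq 0 1 4 5 (by decide) (by simp [pf4, normalForm])
  have h13 : l 1 * l 3 ∈ p.asIdeal := hp <|
    mem_pfaffianIdeal_of_eq 0 2 3 5 (by decide) (by simp [pf4, normalForm])
  have h14 : l 1 * l 4 ∈ p.asIdeal := hp <|
    mem_pfaffianIdeal_of_eq 0 2 4 5 (by decide) (by simp [pf4, normalForm])
  have h2 := or_self_iff.1 (p.isPrime.mem_or_mem h22)
  by_cases h : l 0 ∈ p.asIdeal ∧ l 1 ∈ p.asIdeal
  · exact hl.ringKrullDim_quotient_le p.asIdeal (![3, 4] : Fin 2 → Fin 5) fun i => by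
      fin_cases i <;> simp [h, h2]
  · have h34 : l 3 ∈ p.asIdeal ∧ l 4 ∈ p.asIdeal := by
      have m03 := p.isPrime.mem_or_mem h03
      have m04 := p.isPrime.mem_or_mem h04
      have m13 := p.isPrime.mem_or_mem h13
      have m14 := p.isPrime.mem_or_mem h14
      tauto
    exact hl.ringKrullDim_quotient_le p.asIdeal (![0, 1] : Fin 2 → Fin 5) fun i => by
      fin_cases i <;> simp [h34, h2]

theorem ringKrullDim_normalForm_c_le {l : Fin 5 → P4Ring} (hl : IsLinearCoordinates l) :
    ringKrullDim (P4Ring ⧸ pfaffianIdeal (normalForm .c l)) ≤ 2 := by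
  refine ringKrullDim_quotient_le_of_forall_prime _ _ fun p hp => ?_
  have h11 : l 1 * l 1 ∈ p.asIdeal := hp <|
    mem_pfaffianIdeal_of_eq 0 2 3 4 (by decide) (by simp [pf4, normalForm])
  have h22 : l 2 * l 2 ∈ p.asIdeal := hp <|
    mem_pfaffianIdeal_of_eq 1 2 3 5 (by decide) (by simp [pf4, normalForm])
  have h03 : l 0 * l 3 ∈ p.asIdeal := hp <|
    mem_pfaffianIdeal_of_eq 0 1 4 5 (by decide) (by simp [pf4, normalForm])
  have h1 := or_self_iff.1 (p.isPrime.mem_or_mem h11)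
  have h2 := or_self_iff.1 (p.isPrime.mem_or_mem h22)
  rcases p.isPrime.mem_or_mem h03 with h | h
  · exact hl.ringKrullDim_quotient_le p.asIdeal (![3, 4] : Fin 2 → Fin 5) fun i => by
      fin_cases i <;> simp [h, h1, h2]
  · exact hl.ringKrullDim_quotient_le p.asIdeal (![0, 4] : Fin 2 → Fin 5) fun i => by
      fin_cases i <;> simp [h, h1, h2]

/-- Common to (d), (e) and (f), whose locus is supported on the line l 0 = l 1 = l 2 = 0. -/
theorem ringKrullDim_quotient_le_of_sq_mem {l : Fin 5 → P4Ring} (hl : IsLinearCoordinates l)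
    {I : Ideal P4Ring} (h0 : l 0 * l 0 ∈ I) (h1 : l 1 * l 1 ∈ I) (h2 : l 2 * l 2 ∈ I) :
    ringKrullDim (P4Ring ⧸ I) ≤ 2 := by
  refine ringKrullDim_quotient_le_of_forall_prime _ _ fun p hp => ?_
  have m0 := or_self_iff.1 (p.isPrime.mem_or_mem (hp h0))
  have m1 := or_self_iff.1 (p.isPrime.mem_or_mem (hp h1))
  have m2 := or_self_iff.1 (p.isPrime.mem_or_mem (hp h2))
  exact hl.ringKrullDim_quotient_le p.asIdeal (![3, 4] : Fin 2 → Fin 5) fun i => by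
    fin_cases i <;> simp [m0, m1, m2]

theorem ringKrullDim_normalForm_d_le {l : Fin 5 → P4Ring} (hl : IsLinearCoordinates l) :
    ringKrullDim (P4Ring ⧸ pfaffianIdeal (normalForm .d l)) ≤ 2 :=
  ringKrullDim_quotient_le_of_sq_mem hl
    (mem_pfaffianIdeal_of_eq 0 1 3 4 (by decide) (by simp [pf4, normalForm, mul_comm]))
    (mem_pfaffianIdeal_of_eq 0 2 3 5 (by decide) (by simp [pf4, normalForm, mul_comm]))
    (mem_pfaffianIdeal_of_eq 1 2 4 5 (by decide) (by simp [pf4, normalForm]))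

theorem ringKrullDim_normalForm_e_le {l : Fin 5 → P4Ring} (hl : IsLinearCoordinates l) :
    ringKrullDim (P4Ring ⧸ pfaffianIdeal (normalForm .e l)) ≤ 2 :=
  ringKrullDim_quotient_le_of_sq_mem hl
    (mem_pfaffianIdeal_of_eq 0 1 3 4 (by decide) (by simp [pf4, normalForm, mul_comm]))
    (mem_pfaffianIdeal_of_eq 0 2 3 5 (by decide) (by simp [pf4, normalForm]))
    (mem_pfaffianIdeal_of_eq 1 2 4 5 (by decide) (by simp [pf4, normalForm]))

theorem ringKrullDim_normalForm_f_le {l : Fin 5 → P4Ring} (hl : IsLinearCoordinates l) :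
    ringKrullDim (P4Ring ⧸ pfaffianIdeal (normalForm .f l)) ≤ 2 :=
  ringKrullDim_quotient_le_of_sq_mem hl
    (mem_pfaffianIdeal_of_eq 0 1 3 4 (by decide) (by simp [pf4, normalForm]))
    (mem_pfaffianIdeal_of_eq 0 2 3 5 (by decide) (by simp [pf4, normalForm]))
    (mem_pfaffianIdeal_of_eq 1 2 4 5 (by decide) (by simp [pf4, normalForm]))

/-! ### Types (b) and (c): two lines -/

/-- The maps f and g parametrize the skew lines l 0 = l 1 = l 2 = 0 and l 2 = l 3 = l 4 = 0. A
linear form whose square vanishes on both vanishes on both itself, hence is a multiple of l 2. -/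
theorem topIdeal_normalForm_b {l : Fin 5 → P4Ring} (hl : IsLinearCoordinates l) :
    (∀ u : P4Ring, u.IsHomogeneous 1 → u * u ∈ topIdeal (pfaffianIdeal (normalForm .b l)) →
      u ∈ topIdeal (pfaffianIdeal (normalForm .b l))) ∧
    Module.finrank ℂ (linearPart (topIdeal (pfaffianIdeal (normalForm .b l)))) = 1 ∧
    l 0 ∉ topIdeal (pfaffianIdeal (normalForm .b l)) ∧
    l 3 ∉ topIdeal (pfaffianIdeal (normalForm .b l)) := by
  obtain ⟨hdim, f, hf, hJ⟩ := hl.exists_topIdeal_le_ker (ringKrullDim_normalForm_b_le hl)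
    ![0, 0, 0, TrivSqZeroExt.inl (X 0), TrivSqZeroExt.inl (X 1)] (fun f hf => by
      rw [pfaffianIdeal_le_iff]
      apply exists_quadruple_cases
      simp [pf4, normalForm, RingHom.mem_ker, hf]) 4 3 (m := 0) (by simp) (n := 0) (by simp)
  obtain ⟨-, g, hg, hJ'⟩ := hl.exists_topIdeal_le_ker (ringKrullDim_normalForm_b_le hl)
    ![TrivSqZeroExt.inl (X 0), TrivSqZeroExt.inl (X 1), 0, 0, 0] (fun f hf => by
      rw [pfaffianIdeal_le_iff]
      apply exists_quadruple_cases
      simp [pf4, normalForm, RingHom.mem_ker, hf]) 1 0 (m := 0) (by simp) (n := 0) (by simp)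
  have hs : ∀ i ∈ ({2} : Finset (Fin 5)),
      l i ∈ topIdeal (pfaffianIdeal (normalForm .b l)) := by
    intro i hi
    rw [Finset.mem_singleton] at hi
    subst hi
    refine mem_topIdeal_of_forall fun p _ _ _ hp => ?_
    obtain ⟨j, hj⟩ := hl.exists_notMem hp
    refine ⟨l j, hj, ?_⟩
    fin_cases j
    · exact mem_pfaffianIdeal_of_eq 0 1 3 4 (by decide) (by simp [pf4, normalForm])
    · exact mem_pfaffianIdeal_of_eq 0 2 3 4 (by decide) (by simp [pf4, normalForm])
    · exact mem_pfaffianIdeal_of_eq 1 2 3 4 (by decide) (by simp [pf4, normalForm])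
    · exact mem_pfaffianIdeal_of_eq 1 2 3 5 (by decide) (by simp [pf4, normalForm, mul_comm])
    · exact mem_pfaffianIdeal_of_eq 1 2 4 5 (by decide) (by simp [pf4, normalForm, mul_comm])
  have key : ∀ c : Fin 5 → ℂ, (f (∑ i, c i • l i)).fst = 0 → (g (∑ i, c i • l i)).fst = 0 →
      ∀ i ∉ ({2} : Finset (Fin 5)), c i = 0 := by
    intro c h h'
    simp only [map_sum, map_smul, hf] at h
    simp only [map_sum, map_smul, hg] at h'
    have e1 := sum_mul_eval_fst_eq_zero ![1, 0] h
    have e2 := sum_mul_eval_fst_eq_zero ![0, 1] h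
    have e3 := sum_mul_eval_fst_eq_zero ![1, 0] h'
    have e4 := sum_mul_eval_fst_eq_zero ![0, 1] h'
    simp [Fin.sum_univ_five] at e1 e2 e3 e4
    intro i hi
    fin_cases i <;> simp_all
  have hc : ∀ c : Fin 5 → ℂ, ∑ i, c i • l i ∈ topIdeal (pfaffianIdeal (normalForm .b l)) →
      ∀ i ∉ ({2} : Finset (Fin 5)), c i = 0 := fun c h => key c
    (by rw [hJ _ h, TrivSqZeroExt.fst_zero]) (by rw [hJ' _ h, TrivSqZeroExt.fst_zero])
  refine ⟨fun u hu huu => ?_, ?_, notMem_of_forall_coeff hc (by decide),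
    notMem_of_forall_coeff hc (by decide)⟩
  · obtain ⟨c, rfl⟩ := hl.exists_sum hu
    refine sum_smul_mem_of_forall_coeff {2} hs (key c ?_ ?_)
    · rw [← mul_self_eq_zero, ← TrivSqZeroExt.fst_mul, ← map_mul, hJ _ huu, TrivSqZeroExt.fst_zero]
    · rw [← mul_self_eq_zero, ← TrivSqZeroExt.fst_mul, ← map_mul, hJ' _ huu,
        TrivSqZeroExt.fst_zero]
  · rw [hl.finrank_linearPart _ hs hc]; rfl

/-- As for (b), but the lines l 0 = l 1 = l 2 = 0 and l 1 = l 2 = l 3 = 0 meet and span only the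
plane l 1 = l 2 = 0. -/
theorem topIdeal_normalForm_c {l : Fin 5 → P4Ring} (hl : IsLinearCoordinates l) :
    (∀ u : P4Ring, u.IsHomogeneous 1 → u * u ∈ topIdeal (pfaffianIdeal (normalForm .c l)) →
      u ∈ topIdeal (pfaffianIdeal (normalForm .c l))) ∧
    Module.finrank ℂ (linearPart (topIdeal (pfaffianIdeal (normalForm .c l)))) = 2 ∧
    l 0 ∉ topIdeal (pfaffianIdeal (normalForm .c l)) ∧
    l 3 ∉ topIdeal (pfaffianIdeal (normalForm .c l)) := by
  obtain ⟨hdim, f, hf, hJ⟩ := hl.exists_topIdeal_le_ker (ringKrullDim_normalForm_c_le hl)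
    ![0, 0, 0, TrivSqZeroExt.inl (X 0), TrivSqZeroExt.inl (X 1)] (fun f hf => by
      rw [pfaffianIdeal_le_iff]
      apply exists_quadruple_cases
      simp [pf4, normalForm, RingHom.mem_ker, hf]) 4 3 (m := 0) (by simp) (n := 0) (by simp)
  obtain ⟨-, g, hg, hJ'⟩ := hl.exists_topIdeal_le_ker (ringKrullDim_normalForm_c_le hl)
    ![TrivSqZeroExt.inl (X 0), 0, 0, 0, TrivSqZeroExt.inl (X 1)] (fun f hf => by
      rw [pfaffianIdeal_le_iff]
      apply exists_quadruple_cases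
      simp [pf4, normalForm, RingHom.mem_ker, hf]) 4 0 (m := 0) (by simp) (n := 0) (by simp)
  have hs : ∀ i ∈ ({1, 2} : Finset (Fin 5)),
      l i ∈ topIdeal (pfaffianIdeal (normalForm .c l)) := by
    intro i hi
    fin_cases hi
    -- Since l 4 does not occur in this form, l 4 * l 1 is not in the Pfaffian ideal; multipliers
    -- from l 0, …, l 3 suffice at primes of dimension 2.
    · exact hl.mem_topIdeal hdim
        (mem_pfaffianIdeal_of_eq 0 1 3 4 (by decide) (by simp [pf4, normalForm]))
        (mem_pfaffianIdeal_of_eq 0 2 3 4 (by decide) (by simp [pf4, normalForm]))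
        (mem_pfaffianIdeal_of_eq 0 2 3 5 (by decide) (by simp [pf4, normalForm, mul_comm]))
        (mem_pfaffianIdeal_of_eq 0 2 4 5 (by decide) (by simp [pf4, normalForm, mul_comm]))
    · exact hl.mem_topIdeal hdim
        (mem_pfaffianIdeal_of_eq 0 1 3 5 (by decide) (by simp [pf4, normalForm]))
        (mem_pfaffianIdeal_of_eq 0 2 3 5 (by decide) (by simp [pf4, normalForm]))
        (mem_pfaffianIdeal_of_eq 1 2 3 5 (by decide) (by simp [pf4, normalForm]))
        (mem_pfaffianIdeal_of_eq 1 2 4 5 (by decide) (by simp [pf4, normalForm, mul_comm]))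
  have key : ∀ c : Fin 5 → ℂ, (f (∑ i, c i • l i)).fst = 0 → (g (∑ i, c i • l i)).fst = 0 →
      ∀ i ∉ ({1, 2} : Finset (Fin 5)), c i = 0 := by
    intro c h h'
    simp only [map_sum, map_smul, hf] at h
    simp only [map_sum, map_smul, hg] at h'
    have e1 := sum_mul_eval_fst_eq_zero ![1, 0] h
    have e2 := sum_mul_eval_fst_eq_zero ![0, 1] h
    have e3 := sum_mul_eval_fst_eq_zero ![1, 0] h'
    have e4 := sum_mul_eval_fst_eq_zero ![0, 1] h'
    simp [Fin.sum_univ_five] at e1 e2 e3 e4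
    intro i hi
    fin_cases i <;> simp_all
  have hc : ∀ c : Fin 5 → ℂ, ∑ i, c i • l i ∈ topIdeal (pfaffianIdeal (normalForm .c l)) →
      ∀ i ∉ ({1, 2} : Finset (Fin 5)), c i = 0 := fun c h => key c
    (by rw [hJ _ h, TrivSqZeroExt.fst_zero]) (by rw [hJ' _ h, TrivSqZeroExt.fst_zero])
  refine ⟨fun u hu huu => ?_, ?_, notMem_of_forall_coeff hc (by decide),
    notMem_of_forall_coeff hc (by decide)⟩
  · obtain ⟨c, rfl⟩ := hl.exists_sum hu
    refine sum_smul_mem_of_forall_coeff {1, 2} hs (key c ?_ ?_)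
    · rw [← mul_self_eq_zero, ← TrivSqZeroExt.fst_mul, ← map_mul, hJ _ huu, TrivSqZeroExt.fst_zero]
    · rw [← mul_self_eq_zero, ← TrivSqZeroExt.fst_mul, ← map_mul, hJ' _ huu,
        TrivSqZeroExt.fst_zero]
  · rw [hl.finrank_linearPart _ hs hc]; rfl

/-! ### Types (d), (e), (f): multiple structures on a line -/

theorem topIdeal_normalForm_d {l : Fin 5 → P4Ring} (hl : IsLinearCoordinates l) :
    Module.finrank ℂ (linearPart (topIdeal (pfaffianIdeal (normalForm .d l)))) = 1 ∧
    l 0 * l 0 ∈ topIdeal (pfaffianIdeal (normalForm .d l)) ∧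
    l 0 ∉ topIdeal (pfaffianIdeal (normalForm .d l)) := by
  obtain ⟨hdim, f, hf, hJ⟩ := hl.exists_topIdeal_le_ker (ringKrullDim_normalForm_d_le hl)
    -- The normal direction (l 0 : l 1) = (s : t) turns along the line, as the Pfaffian relation l 0
    -- * l 4 = l 1 * l 3 demands. So neither l 0 nor l 1, nor a combination of them, vanishes.
    ![TrivSqZeroExt.inr (X 0), TrivSqZeroExt.inr (X 1), 0, TrivSqZeroExt.inl (X 0), TrivSqZeroExt.inl (X 1)] (fun f hf => by
      rw [pfaffianIdeal_le_iff]
      apply exists_quadruple_cases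
      simp [pf4, normalForm, RingHom.mem_ker, hf]
      ext <;> simp; ring_nf) 4 3 (m := 0) (by simp) (n := 0) (by simp)
  have hs : ∀ i ∈ ({2} : Finset (Fin 5)),
      l i ∈ topIdeal (pfaffianIdeal (normalForm .d l)) := by
    intro i hi
    rw [Finset.mem_singleton] at hi
    subst hi
    refine mem_topIdeal_of_forall fun p _ _ _ hp => ?_
    obtain ⟨j, hj⟩ := hl.exists_notMem hp
    refine ⟨l j, hj, ?_⟩
    fin_cases j
    · exact mem_pfaffianIdeal_of_eq 0 1 4 5 (by decide) (by simp [pf4, normalForm])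
    · exact mem_pfaffianIdeal_of_eq 0 2 4 5 (by decide) (by simp [pf4, normalForm])
    · exact mem_pfaffianIdeal_of_eq 1 2 4 5 (by decide) (by simp [pf4, normalForm])
    · exact mem_pfaffianIdeal_of_eq 1 3 4 5 (by decide) (by simp [pf4, normalForm, mul_comm])
    · exact mem_pfaffianIdeal_of_eq 2 3 4 5 (by decide) (by simp [pf4, normalForm, mul_comm])
  have hc : ∀ c : Fin 5 → ℂ, ∑ i, c i • l i ∈ topIdeal (pfaffianIdeal (normalForm .d l)) →
      ∀ i ∉ ({2} : Finset (Fin 5)), c i = 0 := by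
    intro c h
    have h0 := hJ _ h
    simp only [map_sum, map_smul, hf] at h0
    have h1 := congrArg TrivSqZeroExt.fst h0
    have e1 := sum_mul_eval_fst_eq_zero ![1, 0] h1
    have e2 := sum_mul_eval_fst_eq_zero ![0, 1] h1
    have e3 := sum_mul_eval_snd_eq_zero ![1, 0] h0
    have e4 := sum_mul_eval_snd_eq_zero ![0, 1] h0
    have e5 := sum_mul_eval_snd_eq_zero ![0, 0] h0
    simp [Fin.sum_univ_five] at e1 e2 e3 e4 e5
    intro i hi
    fin_cases i <;> simp_all
  refine ⟨?_, le_topIdeal _ (mem_pfaffianIdeal_of_eq 0 1 3 4 (by decide) (by simp [pf4, normalForm, mul_comm])),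
    notMem_of_forall_coeff hc (by decide)⟩
  rw [hl.finrank_linearPart _ hs hc]; rfl

theorem topIdeal_normalForm_e {l : Fin 5 → P4Ring} (hl : IsLinearCoordinates l) :
    Module.finrank ℂ (linearPart (topIdeal (pfaffianIdeal (normalForm .e l)))) = 2 ∧
    l 0 * l 0 ∈ topIdeal (pfaffianIdeal (normalForm .e l)) ∧
    l 0 ∉ topIdeal (pfaffianIdeal (normalForm .e l)) := by
  obtain ⟨hdim, f, hf, hJ⟩ := hl.exists_topIdeal_le_ker (ringKrullDim_normalForm_e_le hl)
    -- A constant normal direction: the doubling stays in the plane l 1 = l 2 = 0.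
    ![TrivSqZeroExt.inr 1, 0, 0, TrivSqZeroExt.inl (X 0), TrivSqZeroExt.inl (X 1)] (fun f hf => by
      rw [pfaffianIdeal_le_iff]
      apply exists_quadruple_cases
      simp [pf4, normalForm, RingHom.mem_ker, hf]) 4 3 (m := 0) (by simp) (n := 0) (by simp)
  have hs : ∀ i ∈ ({1, 2} : Finset (Fin 5)),
      l i ∈ topIdeal (pfaffianIdeal (normalForm .e l)) := by
    intro i hi
    fin_cases hi
    · exact hl.mem_topIdeal hdim
        (mem_pfaffianIdeal_of_eq 0 1 3 5 (by decide) (by simp [pf4, normalForm, mul_comm]))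
        (mem_pfaffianIdeal_of_eq 0 2 3 5 (by decide) (by simp [pf4, normalForm]))
        (mem_pfaffianIdeal_of_eq 0 2 4 5 (by decide) (by simp [pf4, normalForm, mul_comm]))
        (mem_pfaffianIdeal_of_eq 0 3 4 5 (by decide) (by simp [pf4, normalForm, mul_comm]))
    · exact hl.mem_topIdeal hdim
        (mem_pfaffianIdeal_of_eq 0 1 4 5 (by decide) (by simp [pf4, normalForm]))
        (mem_pfaffianIdeal_of_eq 0 2 4 5 (by decide) (by simp [pf4, normalForm]))
        (mem_pfaffianIdeal_of_eq 1 2 4 5 (by decide) (by simp [pf4, normalForm]))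
        (mem_pfaffianIdeal_of_eq 1 3 4 5 (by decide) (by simp [pf4, normalForm, mul_comm]))
  have hc : ∀ c : Fin 5 → ℂ, ∑ i, c i • l i ∈ topIdeal (pfaffianIdeal (normalForm .e l)) →
      ∀ i ∉ ({1, 2} : Finset (Fin 5)), c i = 0 := by
    intro c h
    have h0 := hJ _ h
    simp only [map_sum, map_smul, hf] at h0
    have h1 := congrArg TrivSqZeroExt.fst h0
    have e1 := sum_mul_eval_fst_eq_zero ![1, 0] h1
    have e2 := sum_mul_eval_fst_eq_zero ![0, 1] h1
    have e3 := sum_mul_eval_snd_eq_zero ![1, 0] h0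
    have e4 := sum_mul_eval_snd_eq_zero ![0, 1] h0
    have e5 := sum_mul_eval_snd_eq_zero ![0, 0] h0
    simp [Fin.sum_univ_five] at e1 e2 e3 e4 e5
    intro i hi
    fin_cases i <;> simp_all
  refine ⟨?_, le_topIdeal _ (mem_pfaffianIdeal_of_eq 0 1 3 4 (by decide) (by simp [pf4, normalForm, mul_comm])),
    notMem_of_forall_coeff hc (by decide)⟩
  rw [hl.finrank_linearPart _ hs hc]; rfl

theorem topIdeal_normalForm_f {l : Fin 5 → P4Ring} (hl : IsLinearCoordinates l) :
    Module.finrank ℂ (linearPart (topIdeal (pfaffianIdeal (normalForm .f l)))) = 0 ∧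
    l 0 * l 0 ∈ topIdeal (pfaffianIdeal (normalForm .f l)) ∧
    l 0 ∉ topIdeal (pfaffianIdeal (normalForm .f l)) := by
  obtain ⟨hdim, f, hf, hJ⟩ := hl.exists_topIdeal_le_ker (ringKrullDim_normalForm_f_le hl)
    -- The Pfaffian ideal is the square of (l 0, l 1, l 2), so every normal direction is allowed.
    -- The linearly independent values 1, s, t exclude all linear forms at once.
    ![TrivSqZeroExt.inr 1, TrivSqZeroExt.inr (X 0), TrivSqZeroExt.inr (X 1), TrivSqZeroExt.inl (X 0), TrivSqZeroExt.inl (X 1)] (fun f hf => by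
      rw [pfaffianIdeal_le_iff]
      apply exists_quadruple_cases
      simp [pf4, normalForm, RingHom.mem_ker, hf]) 4 3 (m := 0) (by simp) (n := 0) (by simp)
  have hs : ∀ i ∈ (∅ : Finset (Fin 5)),
      l i ∈ topIdeal (pfaffianIdeal (normalForm .f l)) := by
    intro i hi
    simp at hi
  have hc : ∀ c : Fin 5 → ℂ, ∑ i, c i • l i ∈ topIdeal (pfaffianIdeal (normalForm .f l)) →
      ∀ i ∉ (∅ : Finset (Fin 5)), c i = 0 := by
    intro c h
    have h0 := hJ _ h
    simp only [map_sum, map_smul, hf] at h0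
    have h1 := congrArg TrivSqZeroExt.fst h0
    have e1 := sum_mul_eval_fst_eq_zero ![1, 0] h1
    have e2 := sum_mul_eval_fst_eq_zero ![0, 1] h1
    have e3 := sum_mul_eval_snd_eq_zero ![1, 0] h0
    have e4 := sum_mul_eval_snd_eq_zero ![0, 1] h0
    have e5 := sum_mul_eval_snd_eq_zero ![0, 0] h0
    simp [Fin.sum_univ_five] at e1 e2 e3 e4 e5
    intro i hi
    fin_cases i <;> simp_all
  refine ⟨?_, le_topIdeal _ (mem_pfaffianIdeal_of_eq 0 1 3 4 (by decide) (by simp [pf4, normalForm])),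
    notMem_of_forall_coeff hc (by decide)⟩
  rw [hl.finrank_linearPart _ hs hc]; rfl


/-! ### Separating the types -/

/-- The normal form of type `a` is the only one for which the linear forms satisfy the defining
property of prime ideals. -/
theorem not_prime_on_linear_forms {t : FormType} (ht : t ≠ .a) {l : Fin 5 → P4Ring}
    (hl : IsLinearCoordinates l) :
    ∃ u v : P4Ring, u.IsHomogeneous 1 ∧ v.IsHomogeneous 1 ∧
      u * v ∈ topIdeal (pfaffianIdeal (normalForm t l)) ∧
      u ∉ topIdeal (pfaffianIdeal (normalForm t l)) ∧
      v ∉ topIdeal (pfaffianIdeal (normalForm t l)) := by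
  cases t
  · exact absurd rfl ht
  · obtain ⟨-, -, h0, h3⟩ := topIdeal_normalForm_b hl
    exact ⟨l 0, l 3, hl.1 0, hl.1 3, le_topIdeal _ (mem_pfaffianIdeal_of_eq 0 1 3 5 (by decide)
      (by simp [pf4, normalForm])), h0, h3⟩
  · obtain ⟨-, -, h0, h3⟩ := topIdeal_normalForm_c hl
    exact ⟨l 0, l 3, hl.1 0, hl.1 3, le_topIdeal _ (mem_pfaffianIdeal_of_eq 0 1 4 5 (by decide)
      (by simp [pf4, normalForm])), h0, h3⟩
  · obtain ⟨-, h, h0⟩ := topIdeal_normalForm_d hl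
    exact ⟨l 0, l 0, hl.1 0, hl.1 0, h, h0, h0⟩
  · obtain ⟨-, h, h0⟩ := topIdeal_normalForm_e hl
    exact ⟨l 0, l 0, hl.1 0, hl.1 0, h, h0, h0⟩
  · obtain ⟨-, h, h0⟩ := topIdeal_normalForm_f hl
    exact ⟨l 0, l 0, hl.1 0, hl.1 0, h, h0, h0⟩

/-- The top-dimensional component determines the type of a normal form. -/
theorem formType_eq_of_topIdeal_eq {t t' : FormType} {l l' : Fin 5 → P4Ring}
    (hl : IsLinearCoordinates l) (hl' : IsLinearCoordinates l')
    (h : topIdeal (pfaffianIdeal (normalForm t l)) = topIdeal (pfaffianIdeal (normalForm t' l'))) :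
    t = t' := by
  by_cases ht : t = .a
  · by_contra hne
    subst ht
    obtain ⟨u, v, hu, hv, huv, hu', hv'⟩ := not_prime_on_linear_forms (Ne.symm hne) hl'
    rw [← h] at huv hu' hv'
    exact (topIdeal_normalForm_a hl hu hv huv).elim hu' hv'
  by_cases ht' : t' = .a
  · subst ht'
    obtain ⟨u, v, hu, hv, huv, hu', hv'⟩ := not_prime_on_linear_forms ht hl
    rw [h] at huv hu' hv'
    exact ((topIdeal_normalForm_a hl' hu hv huv).elim hu' hv').elim
  -- Pairs from {b, c} and {d, e, f} differ because l 0 has its square but not itself in the ideal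
  -- for the latter. Pairs within one group differ in the dimension of `linearPart`.
  cases t <;> cases t' <;> first | rfl | exact absurd rfl ht | exact absurd rfl ht' | exfalso
  · have := (topIdeal_normalForm_b hl).2.1.symm.trans
      ((congrArg (fun J => Module.finrank ℂ (linearPart J)) h).trans (topIdeal_normalForm_c hl').2.1)
    omega
  · obtain ⟨-, h1, h2⟩ := topIdeal_normalForm_d hl'
    rw [← h] at h1 h2
    exact h2 ((topIdeal_normalForm_b hl).1 _ (hl'.1 0) h1)
  · obtain ⟨-, h1, h2⟩ := topIdeal_normalForm_e hl'
    rw [← h] at h1 h2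
    exact h2 ((topIdeal_normalForm_b hl).1 _ (hl'.1 0) h1)
  · obtain ⟨-, h1, h2⟩ := topIdeal_normalForm_f hl'
    rw [← h] at h1 h2
    exact h2 ((topIdeal_normalForm_b hl).1 _ (hl'.1 0) h1)
  · have := (topIdeal_normalForm_c hl).2.1.symm.trans
      ((congrArg (fun J => Module.finrank ℂ (linearPart J)) h).trans (topIdeal_normalForm_b hl').2.1)
    omega
  · obtain ⟨-, h1, h2⟩ := topIdeal_normalForm_d hl'
    rw [← h] at h1 h2
    exact h2 ((topIdeal_normalForm_c hl).1 _ (hl'.1 0) h1)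
  · obtain ⟨-, h1, h2⟩ := topIdeal_normalForm_e hl'
    rw [← h] at h1 h2
    exact h2 ((topIdeal_normalForm_c hl).1 _ (hl'.1 0) h1)
  · obtain ⟨-, h1, h2⟩ := topIdeal_normalForm_f hl'
    rw [← h] at h1 h2
    exact h2 ((topIdeal_normalForm_c hl).1 _ (hl'.1 0) h1)
  · obtain ⟨-, h1, h2⟩ := topIdeal_normalForm_d hl
    rw [h] at h1 h2
    exact h2 ((topIdeal_normalForm_b hl').1 _ (hl.1 0) h1)
  · obtain ⟨-, h1, h2⟩ := topIdeal_normalForm_d hl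
    rw [h] at h1 h2
    exact h2 ((topIdeal_normalForm_c hl').1 _ (hl.1 0) h1)
  · have := (topIdeal_normalForm_d hl).1.symm.trans
      ((congrArg (fun J => Module.finrank ℂ (linearPart J)) h).trans (topIdeal_normalForm_e hl').1)
    omega
  · have := (topIdeal_normalForm_d hl).1.symm.trans
      ((congrArg (fun J => Module.finrank ℂ (linearPart J)) h).trans (topIdeal_normalForm_f hl').1)
    omega
  · obtain ⟨-, h1, h2⟩ := topIdeal_normalForm_e hl
    rw [h] at h1 h2
    exact h2 ((topIdeal_normalForm_b hl').1 _ (hl.1 0) h1)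
  · obtain ⟨-, h1, h2⟩ := topIdeal_normalForm_e hl
    rw [h] at h1 h2
    exact h2 ((topIdeal_normalForm_c hl').1 _ (hl.1 0) h1)
  · have := (topIdeal_normalForm_e hl).1.symm.trans
      ((congrArg (fun J => Module.finrank ℂ (linearPart J)) h).trans (topIdeal_normalForm_d hl').1)
    omega
  · have := (topIdeal_normalForm_e hl).1.symm.trans
      ((congrArg (fun J => Module.finrank ℂ (linearPart J)) h).trans (topIdeal_normalForm_f hl').1)
    omega
  · obtain ⟨-, h1, h2⟩ := topIdeal_normalForm_f hl
    rw [h] at h1 h2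
    exact h2 ((topIdeal_normalForm_b hl').1 _ (hl.1 0) h1)
  · obtain ⟨-, h1, h2⟩ := topIdeal_normalForm_f hl
    rw [h] at h1 h2
    exact h2 ((topIdeal_normalForm_c hl').1 _ (hl.1 0) h1)
  · have := (topIdeal_normalForm_f hl).1.symm.trans
      ((congrArg (fun J => Module.finrank ℂ (linearPart J)) h).trans (topIdeal_normalForm_d hl').1)
    omega
  · have := (topIdeal_normalForm_f hl).1.symm.trans
      ((congrArg (fun J => Module.finrank ℂ (linearPart J)) h).trans (topIdeal_normalForm_e hl').1)
    omega

theorem mainTheorem12 :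
    -- at most one normal form is congruent to a given matrix
    (∀ M : Matrix (Fin 6) (Fin 6) P4Ring, IsSkewLinear M → pfaffian 3 M = 0 → IsSemistable M →
      ∀ t t' : FormType, IsCongruentToForm M t → IsCongruentToForm M t' → t = t') ∧
    -- the top-dimensional component of the rank-at-most-two locus tells the normal forms apart
    (∀ (t t' : FormType) (l l' : Fin 5 → P4Ring),
      IsLinearCoordinates l → IsLinearCoordinates l' →
      topIdeal (pfaffianIdeal (normalForm t l)) = topIdeal (pfaffianIdeal (normalForm t' l')) →
      t = t') := by
  refine ⟨fun M hM _ _ t t' => ?_, fun t t' l l' hl hl' h => formType_eq_of_topIdeal_eq hl hl' h⟩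
  rintro ⟨S, l, hl, hS⟩ ⟨S', l', hl', hS'⟩
  refine formType_eq_of_topIdeal_eq hl hl' ?_
  rw [← hS, ← hS', hM.pfaffianIdeal_congruence, hM.pfaffianIdeal_congruence]
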